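/- Let $K$ be an algebraically closed field of characteristic zero, let $n\ge 2$, and let $A_n=K[x^n,x^{n-1}y,\ldots,xy^{n-1},y^n]\subseteq K[x,y]$ be the subalgebra generated by all monomials of degree $n$ in $x,y$. Let $K[x,y]_1$ be the linear span of all monomials whose degree is congruent to $1$ modulo $n$, and let $G_n$ be the group (under composition) of all $n$-graded automorphisms of $K[x,y]$, i.e. of all $K$-algebra automorphisms $\phi$ of $K[x,y]$ with $\phi(x),\phi(y)\in K[x,y]_1$. Let $E=\{\epsilon\,\mathrm{id} : \epsilon\in K,\ \epsilon^n=1\}$, where $\epsilon\,\mathrm{id}$ is the automorphism $x\mapsto\epsilon x,\ y\mapsto\epsilon y$. Then $E$ is a normal subgroup of $G_n$, every $\phi\in G_n$ restricts to an automorphism $\overline{\phi}$ of $A_n$, and $\phi\mapsto\overline{\phi}$ induces a group isomorphism $$G_n/E\;\cong\;\mathrm{Aut}\,A_n ,$$ where $\mathrm{Aut}\,A_n$ is the group of $K$-algebra automorphisms of $A_n$. -/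

import Mathlib

namespace Veronese

open MvPolynomial

variable (K : Type*) [Field K] (n : ℕ)

/-- The `ℤ/n`-grading of `K[x, y]`, where `x = X 0` and `y = X 1`: the piece with index `i` consists
of the linear combinations of monomials whose total degree is congruent to `i` modulo `n`. -/
noncomputable def piece (i : ZMod n) : Submodule K (MvPolynomial (Fin 2) K) :=
  weightedHomogeneousSubmodule K (fun _ => (1 : ZMod n)) i

/-- The subalgebra `K[x ^ n, x ^ (n - 1) * y, …, x * y ^ (n - 1), y ^ n]` of `K[x, y]`. -/
noncomputable def veroneseAlgebra : Subalgebra K (MvPolynomial (Fin 2) K) :=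
  Algebra.adjoin K {f | ∃ i ≤ n, f = X 0 ^ (n - i) * X 1 ^ i}

variable {K n}

theorem mem_piece {i : ZMod n} {p : MvPolynomial (Fin 2) K} :
    p ∈ piece K n i ↔ ∀ d : Fin 2 →₀ ℕ, coeff d p ≠ 0 → ((d.degree : ℕ) : ZMod n) = i := by
  have h : ∀ d : Fin 2 →₀ ℕ, Finsupp.weight (fun _ => (1 : ZMod n)) d = ((d.degree : ℕ) : ZMod n) := by
    intro d
    simp [Finsupp.weight_apply, Finsupp.sum_fintype, Finsupp.degree_eq_sum]
  simp only [piece, mem_weightedHomogeneousSubmodule, IsWeightedHomogeneous, h]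

/-- An algebra endomorphism sending `x` and `y` to the first piece preserves every piece. -/
theorem map_mem_piece (φ : MvPolynomial (Fin 2) K →ₐ[K] MvPolynomial (Fin 2) K)
    (hφ : ∀ j, φ (X j) ∈ piece K n 1) {i : ZMod n} {p : MvPolynomial (Fin 2) K}
    (hp : p ∈ piece K n i) : φ p ∈ piece K n i := by
  rw [p.as_sum, map_sum]
  refine Submodule.sum_mem _ fun d hd => ?_
  have hd' := mem_piece.1 hp d (mem_support_iff.1 hd)
  rw [monomial_eq, map_mul, ← algebraMap_eq, AlgHom.commutes, ← Algebra.smul_def]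
  refine Submodule.smul_mem _ _ ?_
  rw [Finsupp.prod_fintype _ _ (by simp), map_prod]
  have := IsWeightedHomogeneous.prod (w := fun _ => (1 : ZMod n)) Finset.univ
    (fun j => φ (X j ^ d j)) (fun j => d j • (1 : ZMod n))
    (fun j _ => by rw [map_pow]; exact IsWeightedHomogeneous.pow (hφ j) (d j))
  have e : ∑ j, d j • (1 : ZMod n) = i := by
    rw [← hd', Finsupp.degree_eq_sum]; simp
  rw [e] at this
  exact this

/-- If moreover the endomorphism is injective, then it also reflects every piece. -/
theorem mem_piece_of_map (φ : MvPolynomial (Fin 2) K →ₐ[K] MvPolynomial (Fin 2) K)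
    (hφ : ∀ j, φ (X j) ∈ piece K n 1) (hinj : Function.Injective φ) {i : ZMod n}
    {p : MvPolynomial (Fin 2) K} (hp : φ p ∈ piece K n i) : p ∈ piece K n i := by
  have hm : ∀ q ∈ piece K n i, weightedHomogeneousComponent (fun _ => (1 : ZMod n)) i q = q :=
    fun q hq => IsWeightedHomogeneous.weightedHomogeneousComponent_same hq
  have hcomm : ∀ q, weightedHomogeneousComponent (fun _ => (1 : ZMod n)) i (φ q) =
      φ (weightedHomogeneousComponent (fun _ => (1 : ZMod n)) i q) := by
    intro q
    induction q using MvPolynomial.induction_on' with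
    | monomial d c =>
      have hd : monomial d c ∈ piece K n (Finsupp.weight (fun _ => (1 : ZMod n)) d) :=
        isWeightedHomogeneous_monomial _ d c rfl
      by_cases h : i = Finsupp.weight (fun _ => (1 : ZMod n)) d
      · rw [← h] at hd
        rw [hm _ hd, hm _ (map_mem_piece φ hφ hd)]
      · rw [IsWeightedHomogeneous.weightedHomogeneousComponent_ne i hd h,
          IsWeightedHomogeneous.weightedHomogeneousComponent_ne i (map_mem_piece φ hφ hd) h,
          map_zero]
    | add p q hp hq => simp only [map_add, hp, hq]
  have := hcomm p
  rw [hm _ hp] at this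
  rw [hinj this]
  exact weightedHomogeneousComponent_mem _ p i

theorem X_mem_piece (j : Fin 2) : (X j : MvPolynomial (Fin 2) K) ∈ piece K n 1 :=
  isWeightedHomogeneous_X K (fun _ => (1 : ZMod n)) j

variable (K n)

/-- The group of `n`-graded automorphisms of `K[x, y]`: those `K`-algebra automorphisms that send
`x` and `y` to the piece with index `1`. The product is composition. -/
noncomputable def gradedAut : Subgroup (MvPolynomial (Fin 2) K ≃ₐ[K] MvPolynomial (Fin 2) K) where
  carrier := {φ | ∀ j, φ (X j) ∈ piece K n 1}
  one_mem' := X_mem_piece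
  mul_mem' {φ ψ} hφ hψ j := map_mem_piece φ.toAlgHom hφ (hψ j)
  inv_mem' {φ} hφ j := by
    refine mem_piece_of_map φ.toAlgHom hφ φ.injective ?_
    have h : φ (φ⁻¹ (X j)) = X j := φ.apply_symm_apply (X j)
    change φ (φ⁻¹ (X j)) ∈ _
    rw [h]
    exact X_mem_piece j

/-- The group of the automorphisms `ε • id : (x, y) ↦ (ε * x, ε * y)` with `ε ^ n = 1`, as a subgroup
of the group of `n`-graded automorphisms. -/
noncomputable def scalarRoots : Subgroup (gradedAut K n) where
  carrier := {φ | ∃ ε : K, ε ^ n = 1 ∧ ∀ j, φ.1 (X j) = ε • X j}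
  one_mem' := ⟨1, one_pow n, fun j => (one_smul K _).symm⟩
  mul_mem' := by
    rintro φ ψ ⟨ε, hε, hφ⟩ ⟨η, hη, hψ⟩
    refine ⟨η * ε, by rw [mul_pow, hε, hη, one_mul], fun j => ?_⟩
    change φ.1 (ψ.1 (X j)) = _
    rw [hψ, map_smul, hφ, smul_smul]
  inv_mem' := by
    rintro φ ⟨ε, hε, hφ⟩
    have hε0 : ε ≠ 0 := by
      rintro rfl
      have h0 : φ.1 (X 0) = φ.1 0 := by rw [hφ, zero_smul, map_zero]
      exact X_ne_zero (0 : Fin 2) (φ.1.injective h0)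
    refine ⟨ε⁻¹, by rw [inv_pow, hε, inv_one], fun j => φ.1.injective ?_⟩
    have h : φ.1 (φ.1⁻¹ (X j)) = X j := φ.1.apply_symm_apply (X j)
    change φ.1 (φ.1⁻¹ (X j)) = _
    rw [h, map_smul, hφ, smul_smul, inv_mul_cancel₀ hε0, one_smul]

variable {K n}

theorem apply_eq_smul {φ : MvPolynomial (Fin 2) K ≃ₐ[K] MvPolynomial (Fin 2) K} {ε : K}
    (hε : ε ^ n = 1) (hφ : ∀ j, φ (X j) = ε • X j) {p : MvPolynomial (Fin 2) K}
    (hp : p ∈ piece K n 1) : φ p = ε • p := by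
  have key : ∀ d ∈ p.support, φ (monomial d (coeff d p)) = ε • monomial d (coeff d p) := by
    intro d hd
    have h1 := mem_piece.1 hp d (mem_support_iff.1 hd)
    have h2 : d.degree ≡ 1 [MOD n] := by
      rw [← ZMod.natCast_eq_natCast_iff, h1, Nat.cast_one]
    have h3 : ε ^ d.degree = ε := by
      rw [pow_eq_pow_mod _ hε, h2, ← pow_eq_pow_mod _ hε, pow_one]
    rw [monomial_eq, map_mul, ← algebraMap_eq, AlgEquiv.commutes, ← mul_smul_comm,
      Finsupp.prod_fintype _ _ (by simp), map_prod]
    congr 1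
    simp only [map_pow, hφ, smul_pow]
    rw [Finset.prod_smul, Finset.prod_pow_eq_pow_sum, ← Finsupp.degree_eq_sum, h3]
  conv_lhs => rw [p.as_sum, map_sum, Finset.sum_congr rfl key, ← Finset.smul_sum, ← p.as_sum]

instance : (scalarRoots K n).Normal where
  conj_mem := by
    rintro φ ⟨ε, hε, hφ⟩ γ
    refine ⟨ε, hε, fun j => ?_⟩
    have h : γ.1 (γ.1⁻¹ (X j)) = X j := γ.1.apply_symm_apply (X j)
    change γ.1 (φ.1 (γ.1⁻¹ (X j))) = _
    rw [apply_eq_smul hε hφ ((gradedAut K n).inv_mem γ.2 j), map_smul, h]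

end Veronese

namespace Veronese

open MvPolynomial

/-! ### Components modulo `n` and linear terms -/

section Grading

variable {K : Type*} [Field K] {n : ℕ}

/-! The point is to lift an automorphism ψ of the Veronese algebra to `K[x, y]` (`exists_lift`). Put
f_i = ψ(x^(n-i) y^i) and write f_1 / f_0, which plays the role of y / x, in lowest terms a / b. The
relations between the generators and coprimality give f_i = h b^(n-i) a^i. Pulled back by ψ, the
factor h divides both x^n and y^n, so it is a constant s^n, and x ↦ s b, y ↦ s a extends ψ. Since
f_0 and f_1 have degree zero modulo `n`, a and b lie in one common piece.

An endomorphism fixing the Veronese algebra is a scalar root of unity. This gives the kernel of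
restriction and, applied to the composites of lifts of ψ and of its inverse, bijectivity of the
lift. Surjectivity onto linear terms then forces the common piece to have index 1. -/

theorem weightedHomogeneousComponent_mul {f : MvPolynomial (Fin 2) K} (hf : f ∈ piece K n 0)
    (i : ZMod n) (g : MvPolynomial (Fin 2) K) :
    weightedHomogeneousComponent (fun _ => (1 : ZMod n)) i (f * g) =
      f * weightedHomogeneousComponent (fun _ => (1 : ZMod n)) i g := by
  induction g using MvPolynomial.induction_on' with
  | monomial d c =>
    have hd : IsWeightedHomogeneous (fun _ => (1 : ZMod n)) (monomial d c)
        (Finsupp.weight (fun _ => (1 : ZMod n)) d) := isWeightedHomogeneous_monomial _ d c rfl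
    have hfd := IsWeightedHomogeneous.mul (w := fun _ => (1 : ZMod n)) hf hd
    rw [zero_add] at hfd
    by_cases h : i = Finsupp.weight (fun _ => (1 : ZMod n)) d
    · rw [← h] at hd hfd
      rw [hd.weightedHomogeneousComponent_same, hfd.weightedHomogeneousComponent_same]
    · rw [hd.weightedHomogeneousComponent_ne i h, hfd.weightedHomogeneousComponent_ne i h,
        mul_zero]
  | add p q hp hq => simp only [mul_add, map_add, hp, hq]

theorem totalDegree_weightedHomogeneousComponent_le (i : ZMod n) (p : MvPolynomial (Fin 2) K) :
    (weightedHomogeneousComponent (fun _ => (1 : ZMod n)) i p).totalDegree ≤ p.totalDegree := by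
  classical
  refine Finset.sup_mono ?_
  rw [support_weightedHomogeneousComponent]
  exact Finset.filter_subset _ _

/-- If a quotient of two elements of the zeroth piece is written in lowest terms, then the numerator
and the denominator lie in a common piece. -/
theorem exists_mem_piece_of_mul_eq_mul {f g a b : MvPolynomial (Fin 2) K}
    (hf : f ∈ piece K n 0) (hg : g ∈ piece K n 0) (hf0 : f ≠ 0) (hb : b ≠ 0)
    (hab : IsRelPrime b a) (h : f * a = g * b) :
    ∃ i : ZMod n, a ∈ piece K n i ∧ b ∈ piece K n i := by
  obtain ⟨i, hi⟩ : ∃ i : ZMod n,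
      weightedHomogeneousComponent (fun _ => (1 : ZMod n)) i b ≠ 0 := by
    obtain ⟨d, hd⟩ := ne_zero_iff.1 hb
    refine ⟨Finsupp.weight (fun _ => (1 : ZMod n)) d, ne_zero_iff.2 ⟨d, ?_⟩⟩
    classical
    rwa [coeff_weightedHomogeneousComponent, if_pos rfl]
  -- The components of `a` and `b` in degree `i` represent the same fraction, with nonzero
  -- denominator.
  have hi' := congrArg (weightedHomogeneousComponent (fun _ => (1 : ZMod n)) i) h
  rw [weightedHomogeneousComponent_mul hf, weightedHomogeneousComponent_mul hg] at hi'
  have ha_mem : weightedHomogeneousComponent (fun _ => (1 : ZMod n)) i a ∈ piece K n i :=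
    weightedHomogeneousComponent_mem _ a i
  have hb_mem : weightedHomogeneousComponent (fun _ => (1 : ZMod n)) i b ∈ piece K n i :=
    weightedHomogeneousComponent_mem _ b i
  have hdeg := totalDegree_weightedHomogeneousComponent_le i b
  revert hi hi' ha_mem hb_mem hdeg
  generalize weightedHomogeneousComponent (fun _ => (1 : ZMod n)) i a = a'
  generalize weightedHomogeneousComponent (fun _ => (1 : ZMod n)) i b = b'
  intro hi hi' ha_mem hb_mem hdeg
  have hcross : b' * a = b * a' := by
    apply mul_left_cancel₀ hf0
    linear_combination b' * h - b * hi'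
  -- Coprimality gives `b ∣ b'`, and `b'` has no larger degree, so the quotient is a constant.
  obtain ⟨c, rfl⟩ : b ∣ b' := hab.dvd_of_dvd_mul_right ⟨a', hcross⟩
  have hc0 : c ≠ 0 := right_ne_zero_of_mul hi
  rw [totalDegree_mul_of_isDomain hb hc0] at hdeg
  obtain ⟨r, rfl⟩ : ∃ r, c = C r := ⟨_, totalDegree_eq_zero_iff_eq_C.1 (by omega)⟩
  have hr : r ≠ 0 := by rintro rfl; simp at hc0
  have ha' : a' = a * C r := mul_left_cancel₀ hb (by linear_combination -hcross)
  subst ha'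
  have hcancel : ∀ p : MvPolynomial (Fin 2) K, p * C r ∈ piece K n i → p ∈ piece K n i := by
    intro p hp
    rw [mul_comm, ← smul_eq_C_mul] at hp
    have := Submodule.smul_mem _ r⁻¹ hp
    rwa [smul_smul, inv_mul_cancel₀ hr, one_smul] at this
  exact ⟨i, hcancel a ha_mem, hcancel b hb_mem⟩

/-- The derivative lies in the piece of index `i - 1 ≠ 0`, which contains no nonzero constant. -/
theorem constantCoeff_pderiv_mem_piece {i : ZMod n} (hi : i ≠ 1) {p : MvPolynomial (Fin 2) K}
    (hp : p ∈ piece K n i) (j : Fin 2) : constantCoeff (pderiv j p) = 0 := by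
  have h : pderiv j p ∈ piece K n (i - 1) :=
    IsWeightedHomogeneous.pderiv (w := fun _ => (1 : ZMod n)) hp (sub_add_cancel i 1)
  by_contra h0
  have := mem_piece.1 h 0 h0
  apply hi
  rw [← sub_eq_zero, ← this]
  simp

/-- The polynomials without linear terms form a subalgebra. -/
theorem constantCoeff_pderiv_apply_eq_zero
    (φ : MvPolynomial (Fin 2) K →ₐ[K] MvPolynomial (Fin 2) K) (j : Fin 2)
    (hφ : ∀ k, constantCoeff (pderiv j (φ (X k))) = 0) (p : MvPolynomial (Fin 2) K) :
    constantCoeff (pderiv j (φ p)) = 0 := by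
  induction p using MvPolynomial.induction_on with
  | C a => rw [← algebraMap_eq, AlgHom.commutes, algebraMap_eq, pderiv_C, map_zero]
  | add p q hp hq => simp [hp, hq]
  | mul_X p k hp => simp [hp, hφ]

/-- For any other index the images of the variables have no linear terms, so `X 0` is not attained.
-/
theorem eq_one_of_surjective (φ : MvPolynomial (Fin 2) K →ₐ[K] MvPolynomial (Fin 2) K)
    (hφ : Function.Surjective φ) {i : ZMod n} (hi : ∀ j, φ (X j) ∈ piece K n i) : i = 1 := by
  by_contra h
  obtain ⟨p, hp⟩ := hφ (X 0)
  have := constantCoeff_pderiv_apply_eq_zero φ 0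
    (fun k => constantCoeff_pderiv_mem_piece h (hi k) 0) p
  rw [hp] at this
  simp at this

end Grading

/-! ### The Veronese algebra and the kernel of restriction -/

section Algebra

variable {K : Type*} [Field K] {n : ℕ}

theorem pow_mul_pow_mem (i : ℕ) (hi : i ≤ n) :
    (X 0 ^ (n - i) * X 1 ^ i : MvPolynomial (Fin 2) K) ∈ veroneseAlgebra K n :=
  Algebra.subset_adjoin ⟨i, hi, rfl⟩

theorem apply_eq_of_apply_pow_mul_pow (φ : MvPolynomial (Fin 2) K →ₐ[K] MvPolynomial (Fin 2) K)
    (ψ : veroneseAlgebra K n →ₐ[K] veroneseAlgebra K n)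
    (h : ∀ (i : ℕ) (hi : i ≤ n), φ (X 0 ^ (n - i) * X 1 ^ i) = ψ ⟨_, pow_mul_pow_mem i hi⟩)
    (a : veroneseAlgebra K n) : φ a = ψ a := by
  have hext : φ.comp (veroneseAlgebra K n).val = (veroneseAlgebra K n).val.comp ψ := by
    refine AlgHom.adjoin_ext ?_
    rintro _ ⟨i, hi, rfl⟩
    exact h i hi
  exact DFunLike.congr_fun hext a

theorem pow_mul_pow_mem_of_add_eq (m : ℕ) : ∀ a b : ℕ, a + b = n * m →
    (X 0 ^ a * X 1 ^ b : MvPolynomial (Fin 2) K) ∈ veroneseAlgebra K n := by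
  induction m with
  | zero =>
    intro a b h
    obtain ⟨rfl, rfl⟩ : a = 0 ∧ b = 0 := by simpa using h
    simp
  | succ m ih =>
    intro a b h
    rw [mul_add, mul_one] at h
    -- Split off the generator containing as many factors y as possible.
    have hb := min_le_right b n
    have hb' := min_le_left b n
    have ha : n - min b n ≤ a := by omega
    convert mul_mem (pow_mul_pow_mem (K := K) (min b n) hb)
      (ih (a - (n - min b n)) (b - min b n) (by omega)) using 1
    rw [mul_mul_mul_comm, ← pow_add, ← pow_add, Nat.add_sub_cancel' ha, Nat.add_sub_cancel' hb']

theorem mem_veroneseAlgebra {p : MvPolynomial (Fin 2) K} :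
    p ∈ veroneseAlgebra K n ↔ p ∈ piece K n 0 := by
  constructor
  · intro hp
    induction hp using Algebra.adjoin_induction with
    | mem f hf =>
      obtain ⟨i, hi, rfl⟩ := hf
      have := IsWeightedHomogeneous.mul (w := fun _ => (1 : ZMod n))
        (IsWeightedHomogeneous.pow (X_mem_piece (K := K) (n := n) 0) (n - i))
        (IsWeightedHomogeneous.pow (X_mem_piece (K := K) (n := n) 1) i)
      rwa [← add_nsmul, Nat.sub_add_cancel hi, nsmul_eq_mul, ZMod.natCast_self, zero_mul] at this
    | algebraMap r => exact isWeightedHomogeneous_C _ r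
    | add p q _ _ hp hq => exact add_mem hp hq
    | mul p q _ _ hp hq =>
      have := IsWeightedHomogeneous.mul (w := fun _ => (1 : ZMod n)) hp hq
      rwa [add_zero] at this
  · intro hp
    rw [p.as_sum]
    refine sum_mem fun d hd => ?_
    have hd' := mem_piece.1 hp d (mem_support_iff.1 hd)
    obtain ⟨m, hm⟩ := (ZMod.natCast_eq_zero_iff _ _).1 hd'
    rw [monomial_eq, ← smul_eq_C_mul, Finsupp.prod_fintype _ _ (by simp), Fin.prod_univ_two]
    refine Subalgebra.smul_mem _ (pow_mul_pow_mem_of_add_eq m _ _ ?_) _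
    rw [← hm, Finsupp.degree_eq_sum, Fin.sum_univ_two]

/-- The restriction of a graded automorphism to the Veronese algebra. -/
noncomputable def restrict (K : Type*) [Field K] (n : ℕ) :
    gradedAut K n →* (veroneseAlgebra K n ≃ₐ[K] veroneseAlgebra K n) where
  toFun φ := AlgEquiv.ofAlgHom
    ((φ.1.toAlgHom.comp (veroneseAlgebra K n).val).codRestrict (veroneseAlgebra K n) fun a =>
      mem_veroneseAlgebra.2 (map_mem_piece φ.1.toAlgHom φ.2 (mem_veroneseAlgebra.1 a.2)))
    ((φ.1⁻¹.toAlgHom.comp (veroneseAlgebra K n).val).codRestrict (veroneseAlgebra K n) fun a =>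
      mem_veroneseAlgebra.2 (map_mem_piece φ.1⁻¹.toAlgHom ((gradedAut K n).inv_mem φ.2)
        (mem_veroneseAlgebra.1 a.2)))
    (AlgHom.ext fun a => Subtype.ext (φ.1.apply_symm_apply a.1))
    (AlgHom.ext fun a => Subtype.ext (φ.1.symm_apply_apply a.1))
  map_one' := rfl
  map_mul' _ _ := rfl

theorem coe_restrict (φ : gradedAut K n) (a : veroneseAlgebra K n) :
    (restrict K n φ a : MvPolynomial (Fin 2) K) = φ.1 a := rfl

/-- The polynomial ring is integrally closed, so `q ∣ p`; the quotient is a unit, hence constant. -/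
theorem exists_smul_of_pow_eq_pow (hn : n ≠ 0) {p q : MvPolynomial (Fin 2) K} (hq : q ≠ 0)
    (h : p ^ n = q ^ n) : ∃ ε : K, ε ^ n = 1 ∧ p = ε • q := by
  obtain ⟨c, rfl⟩ : q ∣ p := (IsIntegrallyClosed.pow_dvd_pow_iff hn).1 (dvd_of_eq h.symm)
  have hc : c ^ n = 1 := mul_left_cancel₀ (pow_ne_zero n hq) (by rw [← mul_pow, h, mul_one])
  obtain ⟨r, -, rfl⟩ := isUnit_iff_eq_C_of_isReduced.1 (IsUnit.of_pow_eq_one hc hn)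
  refine ⟨r, ?_, by rw [smul_eq_C_mul, mul_comm]⟩
  rwa [← C_pow, ← C_1, (C_injective _ _).eq_iff] at hc

/-- An endomorphism of `K[x, y]` that fixes the Veronese algebra is given by a root of unity. -/
theorem exists_smul_of_forall_mem_eq (hn : 2 ≤ n)
    (φ : MvPolynomial (Fin 2) K →ₐ[K] MvPolynomial (Fin 2) K)
    (hφ : ∀ a ∈ veroneseAlgebra K n, φ a = a) :
    ∃ ε : K, ε ^ n = 1 ∧ ∀ j, φ (X j) = ε • X j := by
  have h0 := hφ _ (pow_mul_pow_mem_of_add_eq 1 n 0 (by simp))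
  have h1 := hφ _ (pow_mul_pow_mem_of_add_eq 1 0 n (by simp))
  have h2 := hφ _ (pow_mul_pow_mem_of_add_eq 1 (n - 1) 1 (by omega))
  simp only [pow_zero, mul_one, one_mul, map_pow, map_mul, pow_one] at h0 h1 h2
  obtain ⟨ε, hε, hx⟩ := exists_smul_of_pow_eq_pow (by omega) (X_ne_zero 0) h0
  obtain ⟨η, -, hy⟩ := exists_smul_of_pow_eq_pow (by omega) (X_ne_zero 1) h1
  -- The mixed generator x^(n-1) y forces the two roots of unity to agree.
  have hεη : ε ^ (n - 1) * η = 1 := by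
    rw [hx, hy, smul_pow, smul_mul_smul_comm] at h2
    have hne : (X 0 ^ (n - 1) * X 1 : MvPolynomial (Fin 2) K) ≠ 0 :=
      mul_ne_zero (pow_ne_zero _ (X_ne_zero 0)) (X_ne_zero 1)
    exact smul_left_injective K hne (by simpa using h2)
  have hε1 : ε ^ (n - 1) * ε = 1 := by rw [← pow_succ, Nat.sub_add_cancel (by omega), hε]
  have : η = ε := mul_left_cancel₀ (left_ne_zero_of_mul_eq_one hε1) (hεη.trans hε1.symm)
  subst this
  exact ⟨η, hε, Fin.forall_fin_two.2 ⟨hx, hy⟩⟩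

theorem bijective_of_forall_apply_X {ε : K} (hn : n ≠ 0) (hε : ε ^ n = 1)
    (φ : MvPolynomial (Fin 2) K →ₐ[K] MvPolynomial (Fin 2) K) (hφ : ∀ j, φ (X j) = ε • X j) :
    Function.Bijective φ := by
  have hε0 : ε ≠ 0 := by rintro rfl; simp [hn] at hε
  let ψ : MvPolynomial (Fin 2) K →ₐ[K] MvPolynomial (Fin 2) K := aeval fun j => ε⁻¹ • X j
  have h1 : ψ.comp φ = AlgHom.id K _ := algHom_ext fun j => by simp [ψ, hφ, smul_smul, hε0]
  have h2 : φ.comp ψ = AlgHom.id K _ := algHom_ext fun j => by simp [ψ, hφ, smul_smul, hε0]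
  exact Function.bijective_iff_has_inverse.2 ⟨ψ, DFunLike.congr_fun h1, DFunLike.congr_fun h2⟩

theorem ker_restrict (hn : 2 ≤ n) : (restrict K n).ker = scalarRoots K n := by
  ext φ
  rw [MonoidHom.mem_ker]
  constructor
  · intro h
    refine exists_smul_of_forall_mem_eq hn φ.1.toAlgHom fun a ha => ?_
    exact congrArg Subtype.val (DFunLike.congr_fun h (⟨a, ha⟩ : veroneseAlgebra K n))
  · rintro ⟨ε, hε, hφ⟩
    apply AlgEquiv.ext
    intro a
    apply Subtype.ext
    change φ.1.toAlgHom a.1 = a.1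
    refine Algebra.adjoin_induction (p := fun a _ => φ.1.toAlgHom a = a) ?_ ?_ ?_ ?_ a.2
    · rintro _ ⟨i, hi, rfl⟩
      change φ.1 _ = _
      rw [map_mul, map_pow, map_pow, hφ, hφ, smul_pow, smul_pow, smul_mul_smul_comm, ← pow_add,
        Nat.sub_add_cancel hi, hε, one_smul]
    · exact fun r => φ.1.toAlgHom.commutes r
    · intro p q _ _ hp hq
      rw [map_add, hp, hq]
    · intro p q _ _ hp hq
      rw [map_mul, hp, hq]

end Algebra

/-! ### Lifting automorphisms to the polynomial ring -/

section Lift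

variable {K : Type*} [Field K] [IsAlgClosed K] {n : ℕ}

/-- Every automorphism of the Veronese algebra extends to an endomorphism of `K[x, y]` sending both
variables to the same piece. -/
theorem exists_lift (hn : 2 ≤ n) (ψ : veroneseAlgebra K n ≃ₐ[K] veroneseAlgebra K n) :
    ∃ (φ : MvPolynomial (Fin 2) K →ₐ[K] MvPolynomial (Fin 2) K) (i : ZMod n),
      (∀ j, φ (X j) ∈ piece K n i) ∧ ∀ a : veroneseAlgebra K n, φ a = ψ a := by
  let m : ℕ → veroneseAlgebra K n := fun i => if hi : i ≤ n then ⟨_, pow_mul_pow_mem i hi⟩ else 0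
  have hm : ∀ i ≤ n, (m i : MvPolynomial (Fin 2) K) = X 0 ^ (n - i) * X 1 ^ i := by
    intro i hi
    simp [m, hi]
  let f : ℕ → MvPolynomial (Fin 2) K := fun i => ψ (m i)
  have hf_mem : ∀ i, f i ∈ piece K n 0 := fun i => mem_veroneseAlgebra.1 (ψ (m i)).2
  have hf0 : f 0 ≠ 0 := by
    intro h
    have h' : m 0 = 0 := ψ.injective (by rw [map_zero]; exact Subtype.ext h)
    have := hm 0 (Nat.zero_le n)
    rw [h', Nat.sub_zero, pow_zero, mul_one] at this
    exact pow_ne_zero n (X_ne_zero 0) this.symm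
  -- These relations say that f_i / f_0 = (f_1 / f_0)^i.
  have hf_rel : ∀ i ≤ n, f i * f 0 ^ i = f 0 * f 1 ^ i := by
    intro i hi
    have : m i * m 0 ^ i = m 0 * m 1 ^ i := by
      apply Subtype.ext
      push_cast
      rw [hm i hi, hm 0 (Nat.zero_le n), hm 1 (by omega)]
      obtain ⟨l, rfl⟩ := Nat.exists_eq_add_of_le hi
      obtain rfl | hi0 := Nat.eq_zero_or_pos i
      · simp
      obtain ⟨k, rfl⟩ := Nat.exists_eq_add_of_le' hi0
      rw [Nat.add_sub_cancel_left, Nat.sub_zero, show k + 1 + l - 1 = k + l by omega]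
      ring
    have := congrArg (fun a => (ψ a : MvPolynomial (Fin 2) K)) this
    simpa [f] using this
  obtain ⟨b, a, c, hba, hb, ha⟩ :=
    UniqueFactorizationMonoid.exists_reduced_factors (f 0) hf0 (f 1)
  have hc : c ≠ 0 := by rintro rfl; simp at hb; exact hf0 hb.symm
  have hb0 : b ≠ 0 := by rintro rfl; simp at hb; exact hf0 hb.symm
  obtain ⟨k, hak, hbk⟩ := exists_mem_piece_of_mul_eq_mul (hf_mem 0) (hf_mem 1) hf0 hb0 hba
    (by rw [← ha, ← hb]; ring)
  have hf_ab : ∀ i ≤ n, f i * b ^ i = f 0 * a ^ i := by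
    intro i hi
    apply mul_left_cancel₀ (pow_ne_zero i hc)
    have := hf_rel i hi
    rw [← ha] at this
    nth_rewrite 1 [← hb] at this
    rw [mul_pow, mul_pow] at this
    linear_combination this
  -- The case `i = n` reads f_n b^n = f_0 a^n, with a^n and b^n coprime.
  obtain ⟨h, hh⟩ : b ^ n ∣ f 0 :=
    (hba.pow (m := n) (n := n)).dvd_of_dvd_mul_right ⟨f n, by rw [← hf_ab n le_rfl, mul_comm]⟩
  have hf_eq : ∀ i ≤ n, f i = h * (b ^ (n - i) * a ^ i) := by
    intro i hi
    apply mul_right_cancel₀ (pow_ne_zero i hb0)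
    rw [hf_ab i hi, hh]
    nth_rewrite 1 [← Nat.sub_add_cancel hi]
    ring
  have hg_mem : ∀ i ≤ n, b ^ (n - i) * a ^ i ∈ piece K n 0 := by
    intro i hi
    have := IsWeightedHomogeneous.mul (w := fun _ => (1 : ZMod n))
      (IsWeightedHomogeneous.pow hbk (n - i)) (IsWeightedHomogeneous.pow hak i)
    rwa [← add_nsmul, Nat.sub_add_cancel hi, nsmul_eq_mul, ZMod.natCast_self, zero_mul] at this
  -- Both `f 0` and `b ^ n` have degree zero, hence so does `h`, and `ψ.symm` can be applied to it.
  have hh_mem : h ∈ piece K n 0 := by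
    have h1 := hf_mem 0
    have h2 := hg_mem 0 (Nat.zero_le n)
    rw [Nat.sub_zero, pow_zero, mul_one] at h2
    rw [hh] at h1
    have h3 := weightedHomogeneousComponent_mul h2 0 h
    rw [IsWeightedHomogeneous.weightedHomogeneousComponent_same h1] at h3
    rw [mul_left_cancel₀ (pow_ne_zero n hb0) h3]
    exact weightedHomogeneousComponent_mem _ h 0
  have hdvd : ∀ i ≤ n, ((ψ.symm ⟨h, mem_veroneseAlgebra.2 hh_mem⟩ : veroneseAlgebra K n) :
      MvPolynomial (Fin 2) K) ∣ X 0 ^ (n - i) * X 1 ^ i := by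
    intro i hi
    refine ⟨(ψ.symm ⟨_, mem_veroneseAlgebra.2 (hg_mem i hi)⟩ : veroneseAlgebra K n), ?_⟩
    rw [← MulMemClass.coe_mul, ← map_mul, ← hm i hi]
    refine congrArg Subtype.val ((ψ.symm_apply_eq).2 (Subtype.ext ?_)).symm
    exact (hf_eq i hi).symm
  have hu : IsUnit ((ψ.symm ⟨h, mem_veroneseAlgebra.2 hh_mem⟩ : veroneseAlgebra K n) :
      MvPolynomial (Fin 2) K) := by
    have hx : IsRelPrime (X 0 : MvPolynomial (Fin 2) K) (X 1) := by
      refine (X_prime.irreducible.isRelPrime_iff_not_dvd).2 fun hd => ?_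
      rw [X_dvd_X] at hd
      simp at hd
    have h0 := hdvd 0 (Nat.zero_le n)
    have h1 := hdvd n le_rfl
    simp only [Nat.sub_zero, pow_zero, mul_one, Nat.sub_self, one_mul] at h0 h1
    exact (hx.pow (m := n) (n := n)) h0 h1
  obtain ⟨r, -, hr⟩ := isUnit_iff_eq_C_of_isReduced.1 hu
  have hhr : h = C r := by
    have : ψ.symm ⟨h, mem_veroneseAlgebra.2 hh_mem⟩ = algebraMap K _ r := Subtype.ext hr
    rw [ψ.symm_apply_eq, AlgEquiv.commutes] at this
    exact congrArg Subtype.val this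
  -- An `n`-th root of the constant is absorbed into `a` and `b`.
  obtain ⟨s, rfl⟩ := IsAlgClosed.exists_pow_nat_eq r (show 0 < n by omega)
  let φ : MvPolynomial (Fin 2) K →ₐ[K] MvPolynomial (Fin 2) K := aeval ![s • b, s • a]
  have hφ0 : φ (X 0) = s • b := by simp [φ]
  have hφ1 : φ (X 1) = s • a := by simp [φ]
  refine ⟨φ, k, Fin.forall_fin_two.2 ⟨?_, ?_⟩, ?_⟩
  · rw [hφ0]; exact Submodule.smul_mem _ _ hbk
  · rw [hφ1]; exact Submodule.smul_mem _ _ hak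
  · refine apply_eq_of_apply_pow_mul_pow φ ψ.toAlgHom fun i hi => ?_
    have hmi : m i = ⟨_, pow_mul_pow_mem i hi⟩ := dif_pos hi
    rw [← hmi]
    refine Eq.trans ?_ (show f i = _ from rfl)
    rw [hf_eq i hi, map_mul, map_pow, map_pow, hφ0, hφ1, smul_pow, smul_pow,
      smul_mul_smul_comm, ← pow_add, Nat.sub_add_cancel hi, hhr, smul_eq_C_mul]

theorem restrict_surjective (hn : 2 ≤ n) : Function.Surjective (restrict K n) := by
  intro ψ
  obtain ⟨φ, i, hi, hφ⟩ := exists_lift hn ψ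
  obtain ⟨φ', i', -, hφ'⟩ := exists_lift hn ψ.symm
  obtain ⟨ε, hε, h1⟩ := exists_smul_of_forall_mem_eq hn (φ'.comp φ) fun a ha => by
    change φ' (φ (⟨a, ha⟩ : veroneseAlgebra K n)) = a
    rw [hφ, hφ', ψ.symm_apply_apply]
  obtain ⟨η, hη, h2⟩ := exists_smul_of_forall_mem_eq hn (φ.comp φ') fun a ha => by
    change φ (φ' (⟨a, ha⟩ : veroneseAlgebra K n)) = a
    rw [hφ', hφ, ψ.apply_symm_apply]
  have hinj : Function.Injective φ :=
    Function.Injective.of_comp (f := φ') (bijective_of_forall_apply_X (by omega) hε _ h1).1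
  have hsurj : Function.Surjective φ :=
    Function.Surjective.of_comp (g := φ') (bijective_of_forall_apply_X (by omega) hη _ h2).2
  -- Only now, with surjectivity known, is the index of the lift determined.
  obtain rfl := eq_one_of_surjective φ hsurj hi
  refine ⟨⟨AlgEquiv.ofBijective φ ⟨hinj, hsurj⟩, hi⟩, AlgEquiv.ext fun a => Subtype.ext ?_⟩
  exact hφ a

end Lift

end Veronese

theorem corollary4 (K : Type*) [Field K] [IsAlgClosed K] [CharZero K] (n : ℕ) (hn : 2 ≤ n) :
    ∃ e : Veronese.gradedAut K n ⧸ Veronese.scalarRoots K n ≃*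
        (Veronese.veroneseAlgebra K n ≃ₐ[K] Veronese.veroneseAlgebra K n),
      ∀ (φ : Veronese.gradedAut K n) (a : Veronese.veroneseAlgebra K n),
        (e (QuotientGroup.mk φ) a : MvPolynomial (Fin 2) K) = φ.1 (a : MvPolynomial (Fin 2) K) := by
  refine ⟨(QuotientGroup.quotientMulEquivOfEq (Veronese.ker_restrict hn).symm).trans
    (QuotientGroup.quotientKerEquivOfSurjective _ (Veronese.restrict_surjective hn)), ?_⟩
  exact fun φ a => Veronese.coe_restrict φ a
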